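/- An elementary topos is a category with finite limits and power objects. For an arrow $f:P\to Q$ of an elementary topos $\mathcal E$, the dependent product $\prod^{\mathcal E}_f:\mathcal E/P\to\mathcal E/Q$ is the right adjoint of the pullback functor $f^*:\mathcal E/Q\to\mathcal E/P$ (it always exists); since $f^*$ preserves finite limits, $f^*\dashv\prod^{\mathcal E}_f$ is a geometric morphism $l^{\mathcal E}_f:\mathcal E/P\to\mathcal E/Q$. Let $\mathcal E$ and $\mathcal F$ be elementary toposes and let $i:\mathcal F\hookrightarrow\mathcal E$ be a subtopos, i.e. a geometric morphism $i^*\dashv i_*$ ($i^*$ preserving finite limits) whose direct image $i_*:\mathcal F\to\mathcal E$ is full and faithful. For an object $P$ of $\mathcal E$ let $i_P:\mathcal F/i^*(P)\to\mathcal E/P$ be the induced geometric morphism: its inverse image sends $[h]$ to $[i^*(h)]$, and its direct image $(i_P)_*$ sends $k:K\to i^*(P)$ to the pullback of $i_*(k)$ along the unit $P\to i_*i^*(P)$. Then: 1. For every object $P$ of $\mathcal E$, $i_P$ is a geometric inclusion, i.e. $(i_P)_*$ is full and faithful. 2. For every arrow $f:P\to Q$ of $\mathcal E$ there is a natural isomorphism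 $$(i_Q)_*\circ\textstyle\prod^{\mathcal F}_{i^*(f)}\;\cong\;\textstyle\prod^{\mathcal E}_f\circ (i_P)_*;$$ moreover the square of geometric morphisms commutes up to isomorphism, $i_Q\circ l^{\mathcal F}_{i^*(f)}\cong l^{\mathcal E}_f\circ i_P$, meaning that there are isomorphisms of direct images and of inverse images that correspond to each other under the adjunctions. 3. In particular, for every arrow $f:P\to Q$ of $\mathcal F$, $\prod^{\mathcal F}_f$ is the restriction of the dependent product in $\mathcal E$ along the canonical inclusions $\mathcal F/P\hookrightarrow\mathcal E/i_*(P)$ and $\mathcal F/Q\hookrightarrow\mathcal E/i_*(Q)$, $[h]\mapsto[i_*(h)]$: the composite of $\prod^{\mathcal F}_f$ with the inclusion of $\mathcal F/Q$ is naturally isomorphic to the composite of the inclusion of $\mathcal F/P$ with $\prod^{\mathcal E}_{i_*(f)}$. -/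

import Mathlib

open CategoryTheory CategoryTheory.Limits

universe v u v₁ v₂ v₃ u₁ u₂ u₃

/-! ### Elementary toposes -/

/-- A monomorphism `e : M ⟶ X ⨯ PX` exhibits `PX` as a power object of `X`: every monomorphism
`n : N ⟶ X ⨯ Y` is the pullback of `e` along `𝟙 X × n'` for a unique `n' : Y ⟶ PX`. -/
structure IsPowerObject {E : Type u} [Category.{v} E] [HasFiniteLimits E] {X PX M : E}
    (e : M ⟶ X ⨯ PX) : Prop where
  mono : Mono e
  classify : ∀ {Y N : E} (n : N ⟶ X ⨯ Y), Mono n →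
    ∃! n' : Y ⟶ PX, ∃ t : N ⟶ M, IsPullback t n e (prod.map (𝟙 X) n')

/-- An elementary topos: a category with finite limits and power objects. -/
class ElementaryTopos (E : Type u) [Category.{v} E] : Prop extends HasFiniteLimits E where
  exists_powerObject : ∀ X : E, ∃ (PX M : E) (e : M ⟶ X ⨯ PX), IsPowerObject e

/-! ### Geometric morphisms and subtoposes -/

/-- A geometric morphism `F → E`: an adjunction `inverse ⊣ direct` whose left adjoint preserves
finite limits. -/
structure GeometricMorphism (F : Type u₁) [Category.{v₁} F] (E : Type u₂) [Category.{v₂} E] where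
  inverse : E ⥤ F
  direct : F ⥤ E
  adj : inverse ⊣ direct
  preservesFiniteLimits : PreservesFiniteLimits inverse

namespace GeometricMorphism

section

variable {G : Type u₁} [Category.{v₁} G] {F : Type u₂} [Category.{v₂} F]
  {E : Type u₃} [Category.{v₃} E]

/-- The composite of `φ : G → F` with `ψ : F → E`. -/
def comp (φ : GeometricMorphism G F) (ψ : GeometricMorphism F E) : GeometricMorphism G E where
  inverse := ψ.inverse ⋙ φ.inverse
  direct := φ.direct ⋙ ψ.direct
  adj := ψ.adj.comp φ.adj
  preservesFiniteLimits :=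
    haveI := φ.preservesFiniteLimits
    haveI := ψ.preservesFiniteLimits
    comp_preservesFiniteLimits _ _

/-- An isomorphism of geometric morphisms: isomorphisms of the inverse images and of the direct
images that correspond to each other under the adjunctions. -/
structure Iso (φ ψ : GeometricMorphism F E) where
  inverseIso : φ.inverse ≅ ψ.inverse
  directIso : φ.direct ≅ ψ.direct
  mates : conjugateIsoEquiv φ.adj ψ.adj inverseIso.symm = directIso

/-- A geometric inclusion: the direct image is full and faithful. -/
structure IsInclusion (φ : GeometricMorphism F E) : Prop where
  full : φ.direct.Full
  faithful : φ.direct.Faithful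

/-- The geometric morphism `F / φ^*(X) → E / X` induced by `φ : F → E`: the inverse image applies
`φ^*`, the direct image applies `φ_*` and pulls back along the unit `X ⟶ φ_* φ^* X`. -/
noncomputable def slice [HasPullbacks E] (φ : GeometricMorphism F E) (X : E) :
    GeometricMorphism (Over (φ.inverse.obj X)) (Over X) where
  inverse := Over.post φ.inverse
  direct := Over.post φ.direct ⋙ Over.pullback (φ.adj.unit.app X)
  adj := Over.postAdjunctionLeft φ.adj
  preservesFiniteLimits :=
    haveI := φ.preservesFiniteLimits
    inferInstance

end

end GeometricMorphism

/-! ### Existence of dependent products in an elementary topos -/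

namespace ElementaryTopos

section

variable {C : Type u} [Category.{v} C]

attribute [local simp] prod.lift_fst prod.lift_snd prod.lift_fst_assoc prod.lift_snd_assoc
  pullback.lift_fst pullback.lift_snd pullback.lift_fst_assoc pullback.lift_snd_assoc

/-- A predicate on generalized elements of `X` that is given by a subobject of `X`. -/
def Definable {X : C} (A : ∀ ⦃T : C⦄, (T ⟶ X) → Prop) : Prop :=
  ∃ (S : C) (s : S ⟶ X), Mono s ∧ ∀ ⦃T : C⦄ (t : T ⟶ X), A t ↔ ∃ r : T ⟶ S, r ≫ s = t

lemma Definable.precomp {X : C} {A : ∀ ⦃T : C⦄, (T ⟶ X) → Prop} (hA : Definable A)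
    {T T' : C} (a : T' ⟶ T) (t : T ⟶ X) (ht : A t) : A (a ≫ t) := by
  obtain ⟨S, s, _, h⟩ := hA
  obtain ⟨r, rfl⟩ := (h t).1 ht
  exact (h _).2 ⟨a ≫ r, by simp⟩

variable [ElementaryTopos C]

lemma Definable.eq {X Y : C} (a b : X ⟶ Y) : Definable (fun _ t => t ≫ a = t ≫ b) :=
  ⟨equalizer a b, equalizer.ι a b, inferInstance, fun _ t =>
    ⟨fun h => ⟨equalizer.lift t h, by simp⟩, by
      rintro ⟨r, rfl⟩
      rw [Category.assoc, Category.assoc, equalizer.condition]⟩⟩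

lemma Definable.and {X : C} {A B : ∀ ⦃T : C⦄, (T ⟶ X) → Prop} (hA : Definable A)
    (hB : Definable B) : Definable (fun _ t => A t ∧ B t) := by
  obtain ⟨S, s, _, hS⟩ := hA
  obtain ⟨S', s', _, hS'⟩ := hB
  refine ⟨pullback s s', pullback.fst s s' ≫ s, inferInstance, fun T t => ?_⟩
  change A t ∧ B t ↔ _
  rw [hS, hS']
  constructor
  · rintro ⟨⟨r, hr⟩, ⟨r', hr'⟩⟩
    exact ⟨pullback.lift r r' (by rw [hr, hr']), by simp [hr]⟩
  · rintro ⟨r, rfl⟩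
    exact ⟨⟨r ≫ pullback.fst s s', by simp⟩, ⟨r ≫ pullback.snd s s', by simp [pullback.condition]⟩⟩

lemma Definable.subst {X Y : C} {A : ∀ ⦃T : C⦄, (T ⟶ X) → Prop} (hA : Definable A)
    (φ : Y ⟶ X) : Definable (fun _ t => A (t ≫ φ)) := by
  obtain ⟨S, s, _, hS⟩ := hA
  refine ⟨pullback s φ, pullback.snd s φ, inferInstance, fun T t => ?_⟩
  change A (t ≫ φ) ↔ _
  rw [hS]
  constructor
  · rintro ⟨r, hr⟩
    exact ⟨pullback.lift r t hr, by simp⟩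
  · rintro ⟨r, rfl⟩
    exact ⟨r ≫ pullback.fst s φ, by simp [pullback.condition]⟩

lemma Definable.exists_unique {X Y : C} {A : ∀ ⦃T : C⦄, (T ⟶ Y ⨯ X) → Prop} (hA : Definable A)
    (hu : ∀ ⦃T : C⦄ (y y' : T ⟶ Y) (x : T ⟶ X),
      A (prod.lift y x) → A (prod.lift y' x) → y = y') :
    Definable (fun T (t : T ⟶ X) => ∃ y : T ⟶ Y, A (prod.lift y t)) := by
  obtain ⟨S, s, _, hS⟩ := hA
  refine ⟨S, s ≫ prod.snd, ⟨fun {Z} a b hab => ?_⟩, fun T t => ?_⟩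
  · rw [← cancel_mono s]
    have h1 : a ≫ s = prod.lift (a ≫ s ≫ prod.fst) (a ≫ s ≫ prod.snd) := by
      ext <;> simp
    have h2 : b ≫ s = prod.lift (b ≫ s ≫ prod.fst) (a ≫ s ≫ prod.snd) := by
      ext
      · simp
      · simpa using hab.symm
    have := hu (a ≫ s ≫ prod.fst) (b ≫ s ≫ prod.fst) (a ≫ s ≫ prod.snd)
      (h1 ▸ (hS _).2 ⟨a, rfl⟩) (h2 ▸ (hS _).2 ⟨b, rfl⟩)
    rw [h1, h2, this]
  · constructor
    · rintro ⟨y, hy⟩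
      obtain ⟨r, hr⟩ := (hS _).1 hy
      exact ⟨r, by rw [← Category.assoc, hr]; simp⟩
    · rintro ⟨r, rfl⟩
      refine ⟨r ≫ s ≫ prod.fst, (hS _).2 ⟨r, ?_⟩⟩
      ext <;> simp

/-- Power objects through generalized elements. -/
lemma exists_mem (Y : C) : ∃ (PY : C) (Mem : ∀ ⦃T : C⦄, (T ⟶ Y ⨯ PY) → Prop), Definable Mem ∧
    (∀ ⦃T : C⦄ (S S' : T ⟶ PY), (∀ ⦃T' : C⦄ (a : T' ⟶ T) (y : T' ⟶ Y),
      Mem (prod.lift y (a ≫ S)) ↔ Mem (prod.lift y (a ≫ S'))) → S = S') ∧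
    (∀ ⦃X : C⦄ (A : ∀ ⦃T : C⦄, (T ⟶ Y ⨯ X) → Prop), Definable A → ∃ S : X ⟶ PY,
      ∀ ⦃T' : C⦄ (a : T' ⟶ X) (y : T' ⟶ Y),
        Mem (prod.lift y (a ≫ S)) ↔ A (prod.lift y a)) := by
  obtain ⟨PY, M, e, he⟩ := exists_powerObject Y
  have := he.mono
  refine ⟨PY, fun T t => ∃ r : T ⟶ M, r ≫ e = t, ⟨M, e, he.mono, fun _ _ => Iff.rfl⟩, ?_, ?_⟩
  · intro T S S' h
    let n := pullback.snd e (prod.map (𝟙 Y) S)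
    obtain ⟨_, _, hu⟩ := he.classify n inferInstance
    have key : ∃ t, IsPullback t n e (prod.map (𝟙 Y) S') := by
      obtain ⟨r, hr⟩ := (h (n ≫ prod.snd) (n ≫ prod.fst)).1
        ⟨pullback.fst e (prod.map (𝟙 Y) S), by
          rw [pullback.condition]; ext <;> simp [n]⟩
      have hr' : r ≫ e = n ≫ prod.map (𝟙 Y) S' := by rw [hr]; ext <;> simp
      refine ⟨r, ⟨hr'⟩, ⟨PullbackCone.IsLimit.mk _ (fun s => ?_) ?_ ?_ ?_⟩⟩
      · have hs := s.condition
        have : ∃ q : s.pt ⟶ M, q ≫ e =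
            prod.lift (s.snd ≫ prod.fst) ((s.snd ≫ prod.snd) ≫ S) :=
          (h (s.snd ≫ prod.snd) (s.snd ≫ prod.fst)).2 ⟨s.fst, by rw [hs]; ext <;> simp⟩
        exact pullback.lift this.choose s.snd (by rw [this.choose_spec]; ext <;> simp)
      · intro s
        rw [← cancel_mono e, Category.assoc, hr', ← Category.assoc]
        simp [n, s.condition]
      · intro s
        simp [n]
      · intro s m _ h2
        rw [← cancel_mono n, h2]
        simp [n]
    exact (hu S ⟨_, IsPullback.of_hasPullback _ _⟩).trans (hu S' key).symm
  · rintro X A ⟨N, n, hn, hA⟩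
    obtain ⟨S, ⟨t, ht⟩, _⟩ := he.classify n hn
    refine ⟨S, fun T' a y => ?_⟩
    rw [hA]
    have hc : prod.lift y (a ≫ S) = prod.lift y a ≫ prod.map (𝟙 Y) S := by ext <;> simp
    constructor
    · rintro ⟨r, hr⟩
      exact ⟨ht.lift r (prod.lift y a) (hr.trans hc), by simp⟩
    · rintro ⟨r, hr⟩
      exact ⟨r ≫ t, by rw [Category.assoc, ht.w, ← Category.assoc, hr, hc]⟩

lemma Definable.forall_imp {X Y : C} {A B : ∀ ⦃T : C⦄, (T ⟶ Y ⨯ X) → Prop} (hA : Definable A)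
    (hB : Definable B) : Definable (fun T (t : T ⟶ X) => ∀ ⦃T' : C⦄ (a : T' ⟶ T) (y : T' ⟶ Y),
      A (prod.lift y (a ≫ t)) → B (prod.lift y (a ≫ t))) := by
  obtain ⟨PY, Mem, _, hext, hcl⟩ := exists_mem Y
  obtain ⟨S, hS⟩ := hcl A hA
  obtain ⟨S', hS'⟩ := hcl _ (hA.and hB)
  obtain ⟨Z, z, hz, h⟩ := Definable.eq S S'
  refine ⟨Z, z, hz, fun T t => ?_⟩
  rw [← h t]
  constructor
  · intro H
    refine hext _ _ fun T' a y => ?_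
    rw [← Category.assoc, ← Category.assoc, hS, hS']
    exact ⟨fun hA => ⟨hA, H a y hA⟩, And.left⟩
  · intro H T' a y hy
    have := (hS (a ≫ t) y).2 hy
    rw [Category.assoc, H, ← Category.assoc, hS'] at this
    exact this.2

/-- In an elementary topos the pullback functors between slices have right adjoints. -/
theorem pullback_isLeftAdjoint {P Q : C} (f : P ⟶ Q) : (Over.pullback f).IsLeftAdjoint := by
  rw [isLeftAdjoint_iff_hasTerminal_costructuredArrow]
  intro h
  obtain ⟨PH, Mem, hMem, hext, hcl⟩ := exists_mem h.left
  have hpre : ∀ ⦃T T' : C⦄ (a : T' ⟶ T) (x : T ⟶ h.left) (S : T ⟶ PH), Mem (prod.lift x S) →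
      Mem (prod.lift (a ≫ x) (a ≫ S)) := fun T T' a x S hx => by
    rw [← prod.comp_lift]
    exact hMem.precomp a _ hx
  have hd1 := Definable.forall_imp (X := Q ⨯ PH)
    (hMem.subst (prod.map (𝟙 h.left) (prod.snd : Q ⨯ PH ⟶ PH)))
    (Definable.eq (prod.fst ≫ h.hom ≫ f) (prod.snd ≫ prod.fst))
  have hd3 := Definable.forall_imp (X := h.left ⨯ (P ⨯ (Q ⨯ PH)))
    ((hMem.subst (prod.map (𝟙 h.left) (prod.snd ≫ prod.snd ≫ prod.snd))).and
      (Definable.eq (prod.fst ≫ h.hom) (prod.snd ≫ prod.snd ≫ prod.fst)))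
    (Definable.eq prod.fst (prod.snd ≫ prod.fst))
  have hd4 := ((Definable.eq (X := h.left ⨯ (P ⨯ (Q ⨯ PH))) (prod.fst ≫ h.hom)
    (prod.snd ≫ prod.fst)).and
      (hMem.subst (prod.map (𝟙 h.left) (prod.snd ≫ prod.snd)))).and hd3
  have hd5 := Definable.forall_imp (X := Q ⨯ PH)
    (Definable.eq (prod.fst ≫ f) (prod.snd ≫ prod.fst))
    (hd4.exists_unique (fun T y y' x hy hy' => by
      have := hy'.2 (𝟙 _) y ⟨by simpa using hy.1.2, by simpa using hy.1.1⟩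
      simpa using this))
  obtain ⟨W, s, hs, hW⟩ := hd1.and hd5
  have hW' : ∀ ⦃T : C⦄ (t : T ⟶ Q ⨯ PH), (∃ r : T ⟶ W, r ≫ s = t) ↔
      (∀ ⦃T' : C⦄ (a : T' ⟶ T) (x : T' ⟶ h.left), Mem (prod.lift x (a ≫ t ≫ prod.snd)) →
        x ≫ h.hom ≫ f = a ≫ t ≫ prod.fst) ∧
      (∀ ⦃T' : C⦄ (a : T' ⟶ T) (p : T' ⟶ P), p ≫ f = a ≫ t ≫ prod.fst →
        ∃ x : T' ⟶ h.left, (x ≫ h.hom = p ∧ Mem (prod.lift x (a ≫ t ≫ prod.snd))) ∧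
          ∀ ⦃T'' : C⦄ (b : T'' ⟶ T') (x' : T'' ⟶ h.left),
            Mem (prod.lift x' (b ≫ a ≫ t ≫ prod.snd)) → x' ≫ h.hom = b ≫ p → x' = b ≫ x) := by
    intro T t
    rw [← hW t]
    simp [prod.lift_map]
  clear hW hd1 hd3 hd4 hd5
  obtain ⟨hs1, hs2⟩ := (hW' s).1 ⟨𝟙 _, by simp⟩
  obtain ⟨x₀, ⟨hx1, hx2⟩, hx3⟩ := hs2 (pullback.fst (s ≫ prod.fst) f)
    (pullback.snd (s ≫ prod.fst) f) pullback.condition.symm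
  let ev : (Over.pullback f).obj (Over.mk (s ≫ prod.fst)) ⟶ h := Over.homMk x₀ hx1
  have main : ∀ (K : Over Q) (g : (Over.pullback f).obj K ⟶ h),
      ∃! u : K ⟶ Over.mk (s ≫ prod.fst), (Over.pullback f).map u ≫ ev = g := by
    intro K g
    have hg : g.left ≫ h.hom = pullback.snd K.hom f := Over.w g
    let γ : pullback K.hom f ⟶ h.left := g.left
    have hγ : γ ≫ h.hom = pullback.snd K.hom f := hg
    let n : pullback K.hom f ⟶ h.left ⨯ K.left := prod.lift γ (pullback.fst K.hom f)
    have hn : Mono n := ⟨fun a b hab => by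
      have e1 : a ≫ γ = b ≫ γ := by
        simpa [n] using congrArg (· ≫ prod.fst) hab
      have e2 : a ≫ pullback.fst K.hom f = b ≫ pullback.fst K.hom f := by
        simpa [n] using congrArg (· ≫ prod.snd) hab
      ext
      · exact e2
      · rw [← hγ, ← Category.assoc, e1, Category.assoc]⟩
    obtain ⟨S, hS⟩ := hcl (fun T t => ∃ d, d ≫ n = t) ⟨_, n, hn, fun _ _ => Iff.rfl⟩
    have hS' : ∀ ⦃T : C⦄ (a : T ⟶ K.left) (y : T ⟶ h.left), Mem (prod.lift y (a ≫ S)) ↔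
        ∃ d : T ⟶ pullback K.hom f, d ≫ γ = y ∧ d ≫ pullback.fst K.hom f = a := by
      intro T a y
      rw [hS]
      refine exists_congr fun d => ⟨fun hd => ⟨?_, ?_⟩, fun hd => ?_⟩
      · simpa [n] using congrArg (· ≫ prod.fst) hd
      · simpa [n] using congrArg (· ≫ prod.snd) hd
      · ext
        · simpa [n] using hd.1
        · simpa [n] using hd.2
    obtain ⟨r, hr⟩ := (hW' (prod.lift K.hom S)).2 ⟨by
        intro T' a x hx
        simp only [prod.lift_snd] at hx
        obtain ⟨d, rfl, rfl⟩ := (hS' _ _).1 hx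
        simp only [prod.lift_fst, Category.assoc, reassoc_of% hγ, pullback.condition], by
        intro T' a p hp
        simp only [prod.lift_fst] at hp
        refine ⟨pullback.lift a p hp.symm ≫ γ, ⟨by simp [hγ], ?_⟩, ?_⟩
        · simp only [prod.lift_snd]
          exact (hS' _ _).2 ⟨_, rfl, by simp⟩
        · intro T'' b x' hx' hp'
          simp only [prod.lift_snd, ← Category.assoc] at hx'
          obtain ⟨d, rfl, hd⟩ := (hS' _ _).1 hx'
          rw [← Category.assoc]
          congr 1
          ext
          · simpa using hd
          · rw [Category.assoc, hγ] at hp'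
            simpa using hp'⟩
    have hr1 : r ≫ s ≫ prod.fst = K.hom := by
      rw [← Category.assoc, hr]; simp
    have hr2 : r ≫ s ≫ prod.snd = S := by
      rw [← Category.assoc, hr]; simp
    refine ⟨Over.homMk r hr1, ?_, ?_⟩
    · ext
      let m : pullback K.hom f ⟶ pullback (s ≫ prod.fst) f :=
        ((Over.pullback f).map (Over.homMk r hr1 : K ⟶ Over.mk (s ≫ prod.fst))).left
      have hm1 : m ≫ pullback.fst _ _ = pullback.fst _ _ ≫ r := by
        simp [m]
      have hm2 : m ≫ pullback.snd _ _ = pullback.snd _ _ := by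
        simp [m]
      change m ≫ x₀ = γ
      refine (hx3 m γ ?_ (hγ.trans hm2.symm)).symm
      rw [reassoc_of% hm1, hr2, hS']
      exact ⟨𝟙 _, by simp, by simp⟩
    · intro u hu
      let w : K.left ⟶ W := u.left
      have hw : w ≫ s ≫ prod.fst = K.hom := Over.w u
      let m : pullback K.hom f ⟶ pullback (s ≫ prod.fst) f := ((Over.pullback f).map u).left
      have hm1 : m ≫ pullback.fst _ _ = pullback.fst _ _ ≫ w := by
        simp [m, w]
      have hm2 : m ≫ pullback.snd _ _ = pullback.snd _ _ := by
        simp [m]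
      have hmg : m ≫ x₀ = γ := congrArg (fun q => q.left) hu
      ext
      change w = r
      rw [← cancel_mono s]
      ext
      · rw [Category.assoc, Category.assoc, hw, hr1]
      · rw [Category.assoc, Category.assoc, hr2]
        refine hext _ _ fun T a y => ?_
        rw [hS']
        constructor
        · intro hy
          have h1 := hs1 (a ≫ w) y (by simpa using hy)
          rw [Category.assoc, hw] at h1
          refine ⟨pullback.lift a (y ≫ h.hom) (by simpa using h1.symm), ?_, by simp⟩
          rw [← hmg, ← Category.assoc]
          refine (hx3 _ _ ?_ ?_).symm
          · rw [Category.assoc, reassoc_of% hm1]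
            simpa using hy
          · simp [hm2]
        · rintro ⟨d, rfl, rfl⟩
          have := hpre (d ≫ m) _ _ hx2
          rw [Category.assoc, hmg] at this
          simpa [reassoc_of% hm1] using this
  let X₀ : CostructuredArrow (Over.pullback f) h := CostructuredArrow.mk ev
  have : ∀ B : CostructuredArrow (Over.pullback f) h, Unique (B ⟶ X₀) := fun B =>
    { default := CostructuredArrow.homMk (main B.left B.hom).choose
        (main B.left B.hom).choose_spec.1
      uniq := fun q => CostructuredArrow.hom_ext _ _
        ((main B.left B.hom).choose_spec.2 q.left (CostructuredArrow.w q)) }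
  exact hasTerminal_of_unique X₀

end

end ElementaryTopos

/-- The dependent product along `f`: the right adjoint of pullback along `f`. -/
noncomputable def dependentProduct {E : Type u} [Category.{v} E] [ElementaryTopos E] {P Q : E}
    (f : P ⟶ Q) : Over P ⥤ Over Q :=
  haveI := ElementaryTopos.pullback_isLeftAdjoint f
  (Over.pullback f).rightAdjoint

/-- Pullback along `f` is left adjoint to the dependent product along `f`. -/
noncomputable def dependentProductAdj {E : Type u} [Category.{v} E] [ElementaryTopos E] {P Q : E}
    (f : P ⟶ Q) : Over.pullback f ⊣ dependentProduct f :=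
  haveI := ElementaryTopos.pullback_isLeftAdjoint f
  Adjunction.ofIsLeftAdjoint (Over.pullback f)

/-- The geometric morphism `E / P → E / Q` induced by `f : P ⟶ Q`. -/
noncomputable def sliceGeometricMorphism {E : Type u} [Category.{v} E] [ElementaryTopos E]
    {P Q : E} (f : P ⟶ Q) : GeometricMorphism (Over P) (Over Q) where
  inverse := Over.pullback f
  direct := dependentProduct f
  adj := dependentProductAdj f
  preservesFiniteLimits :=
    haveI := (Over.mapPullbackAdj f).rightAdjoint_preservesLimits
    inferInstance

/-! ### Base change between slice categories -/

section

variable {C : Type u₁} [Category.{v₁} C] {D : Type u₂} [Category.{v₂} D]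

/-! The dependent products enter only as right adjoints. An isomorphism between composites of right
adjoints is the same as one between their left adjoints, in the opposite direction
(`conjugateIsoEquiv`), and here all left adjoints are pullback, postcomposition or application of
`i^*`. For the square of geometric morphisms, the isomorphism of left adjoints says that `i^*`
preserves pullbacks (`overPostPullbackIso`). For the restriction statement over `F`, the left
adjoint of `F/P ⥤ E/i_*(P)` is `i^*` followed by postcomposition with the counit, so Beck–Chevalley
for the naturality square of the counit (`overMapPullbackIso`) is needed too. Full faithfulness of
`(i_P)_*` amounts to invertibility of its counit, computed in `slice_counit_app_left`. -/

/-- A pullback-preserving functor commutes with pullback between slices. -/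
noncomputable def overPostPullbackIso [HasPullbacks C] [HasPullbacks D] (L : C ⥤ D)
    [PreservesLimitsOfShape WalkingCospan L] {P Q : C} (f : P ⟶ Q) :
    Over.post L ⋙ Over.pullback (L.map f) ≅ Over.pullback f ⋙ Over.post L :=
  NatIso.ofComponents
    (fun X => Over.isoMk (PreservesPullback.iso L X.hom f).symm 
      (PreservesPullback.iso_inv_snd L X.hom f))
    (fun {X Y} g => by
      ext
      change pullback.lift (pullback.fst (L.map X.hom) (L.map f) ≫ L.map g.left)
          (pullback.snd (L.map X.hom) (L.map f)) _ ≫ (PreservesPullback.iso L Y.hom f).inv =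
        (PreservesPullback.iso L X.hom f).inv ≫ L.map (pullback.lift (pullback.fst X.hom f ≫ g.left)
          (pullback.snd X.hom f) _)
      -- Moving the comparison isomorphism across makes both sides maps into a pullback in `D`,
      -- where the two projections decide equality.
      rw [Iso.comp_inv_eq]
      apply pullback.hom_ext
      · refine (pullback.lift_fst _ _ _).trans ?_
        simp only [Category.assoc, PreservesPullback.iso_hom_fst, ← Functor.map_comp,
          pullback.lift_fst]
        simp only [Functor.map_comp, PreservesPullback.iso_inv_fst_assoc]
      · refine (pullback.lift_snd _ _ _).trans ?_
        simp [pullback.lift_snd])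

/-- Beck–Chevalley: pushing forward commutes with pulling back along a pullback square. -/
noncomputable def overMapPullbackIso [HasPullbacks D] {P Q P' Q' : D} {f' : P' ⟶ Q'} {p : P' ⟶ P}
    {q : Q' ⟶ Q} {f : P ⟶ Q} (h : IsPullback p f' f q) :
    Over.map q ⋙ Over.pullback f ≅ Over.pullback f' ⋙ Over.map p :=
  NatIso.ofComponents
    -- Pasting the pullback of `X.hom` along `f'` with `h` gives a pullback of `X.hom ≫ q` along
    -- `f`.
    (fun X => Over.isoMk ((IsPullback.of_hasPullback X.hom f').flip.paste_horiz
      h).flip.isoPullback.symm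
      (by
        dsimp
        rw [Iso.inv_comp_eq]
        exact (IsPullback.isoPullback_hom_snd _).symm))
    (fun {X Y} g => by
      ext
      rw [← cancel_mono ((IsPullback.of_hasPullback Y.hom f').flip.paste_horiz
        h).flip.isoPullback.hom]
      apply pullback.hom_ext
      · simp [pullback.lift_fst]
      · simp [pullback.lift_snd, pullback.lift_snd_assoc])

end

/-! ### Slices of geometric morphisms and of inclusions -/

namespace GeometricMorphism

variable {F : Type u₁} [Category.{v₁} F] {E : Type u₂} [Category.{v₂} E]

/-- This splits the sliced counit into two factors, each of which can be inverted separately when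
`φ` is an inclusion. -/
lemma slice_counit_app_left [HasPullbacks E] (φ : GeometricMorphism F E) (X : E)
    (k : Over (φ.inverse.obj X)) :
    ((φ.slice X).adj.counit.app k).left =
      φ.inverse.map (pullback.fst (φ.direct.map k.hom) (φ.adj.unit.app X)) ≫
        φ.adj.counit.app k.left := by
  simp [slice, Over.postAdjunctionLeft, Adjunction.ofNatIsoLeft]
  exact Category.id_comp _

/-- A right adjoint is full and faithful as soon as its counit is invertible, and `Over.forget`
reflects isomorphisms, so underlying arrows suffice. -/
lemma IsInclusion.slice [HasPullbacks E] {φ : GeometricMorphism F E} (hφ : φ.IsInclusion)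
    (X : E) : (φ.slice X).IsInclusion := by
  have := hφ.full
  have := hφ.faithful
  have := φ.preservesFiniteLimits
  have (k : Over (φ.inverse.obj X)) : IsIso ((φ.slice X).adj.counit.app k) := by
    have : IsIso ((φ.slice X).adj.counit.app k).left := by
      rw [slice_counit_app_left]
      -- The counit of `φ` is invertible, hence by a triangle identity so is the image of the unit
      -- under `φ.inverse`. The image of the first projection is a pullback of that arrow.
      have h := ((IsPullback.of_hasPullback (φ.direct.map k.hom) (φ.adj.unit.app X)).map
        φ.inverse).isIso_fst_of_isIso
      exact @IsIso.comp_isIso _ _ _ _ _ _ _ h inferInstance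
    have : IsIso ((Over.forget _).map ((φ.slice X).adj.counit.app k)) := this
    exact isIso_of_reflects_iso _ (Over.forget _)
  have : IsIso (φ.slice X).adj.counit := NatIso.isIso_of_isIso_app _
  have h := (φ.slice X).adj.fullyFaithfulROfIsIsoCounit
  exact ⟨h.full, h.faithful⟩

/-- Slicing a geometric morphism is compatible with the geometric morphisms between slices. -/
noncomputable def sliceCompIso [ElementaryTopos E] [ElementaryTopos F]
    (φ : GeometricMorphism F E) {P Q : E} (f : P ⟶ Q) :
    Iso ((sliceGeometricMorphism (φ.inverse.map f)).comp (φ.slice Q))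
      ((φ.slice P).comp (sliceGeometricMorphism f)) :=
  haveI := φ.preservesFiniteLimits
  { inverseIso := overPostPullbackIso φ.inverse f
    -- Taking the direct isomorphism to be the mate of the inverse one makes the compatibility hold
    -- by definition.
    directIso := conjugateIsoEquiv _ _ (overPostPullbackIso φ.inverse f).symm
    mates := rfl }

/-- For a geometric inclusion, the dependent product of the subtopos is the restriction of the
ambient one. -/
noncomputable def IsInclusion.dependentProductIso [ElementaryTopos E] [ElementaryTopos F]
    {φ : GeometricMorphism F E} (hφ : φ.IsInclusion) {P Q : F} (f : P ⟶ Q) :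
    dependentProduct f ⋙ Over.post φ.direct ≅
      Over.post φ.direct ⋙ dependentProduct (φ.direct.map f) :=
  haveI := hφ.full
  haveI := hφ.faithful
  haveI := φ.preservesFiniteLimits
  -- A commutative square with two opposite sides invertible is a pullback; here these sides are
  -- counit components, invertible because `φ.direct` is full and faithful.
  have sq : IsPullback (φ.adj.counit.app P) (φ.inverse.map (φ.direct.map f)) f
      (φ.adj.counit.app Q) := .of_horiz_isIso ⟨(φ.adj.counit.naturality f).symm⟩
  conjugateIsoEquiv
    ((Over.postAdjunctionRight φ.adj).comp (dependentProductAdj f))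
    ((dependentProductAdj (φ.direct.map f)).comp (Over.postAdjunctionRight φ.adj))
    -- Pullback along `f` first moves past postcomposition with the counit, then past `φ.inverse`,
    -- where it becomes pullback along `φ.direct.map f`.
    (Functor.associator _ _ _ ≪≫ Functor.isoWhiskerLeft _ (overMapPullbackIso sq) ≪≫
      (Functor.associator _ _ _).symm ≪≫
      Functor.isoWhiskerRight (overPostPullbackIso φ.inverse (φ.direct.map f)) _ ≪≫
      Functor.associator _ _ _).symm

end GeometricMorphism

theorem mainTheorem7 {E : Type u₁} [Category.{v₁} E] [ElementaryTopos E]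
    {F : Type u₂} [Category.{v₂} F] [ElementaryTopos F]
    (i : GeometricMorphism F E) (hi : i.IsInclusion) :
    (∀ P : E, (i.slice P).IsInclusion) ∧
    (∀ {P Q : E} (f : P ⟶ Q),
      Nonempty (dependentProduct (i.inverse.map f) ⋙ (i.slice Q).direct ≅
        (i.slice P).direct ⋙ dependentProduct f) ∧
      Nonempty (GeometricMorphism.Iso
        ((sliceGeometricMorphism (i.inverse.map f)).comp (i.slice Q))
        ((i.slice P).comp (sliceGeometricMorphism f)))) ∧
    (∀ {P Q : F} (f : P ⟶ Q),
      Nonempty (dependentProduct f ⋙ Over.post i.direct ≅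
        Over.post i.direct ⋙ dependentProduct (i.direct.map f))) :=
  ⟨hi.slice, fun f => ⟨⟨(i.sliceCompIso f).directIso⟩, ⟨i.sliceCompIso f⟩⟩,
    fun f => ⟨hi.dependentProductIso f⟩⟩
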